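/- Let $\Omega=(a,b)\times(c,d)\subset\mathbb R^2$, $T>0$, $\alpha\in(0,1)$, and let $\epsilon_0,\epsilon_\infty,\mu_0,\tau_0>0$ and $\epsilon_s>\epsilon_\infty$. Write $(\cdot,\cdot)$ and $\|\cdot\|$ for the inner product and norm of $L^2(\Omega)$ (scalar or $\mathbb R^2$-valued). Let $(\mathcal I^{\beta}u)(t)=\frac1{\Gamma(\beta)}\int_0^t (t-s)^{\beta-1}u(s)\,ds$ be the Riemann--Liouville integral, $\partial_t^\alpha u=\mathcal I^{1-\alpha}\partial_t u$ the Caputo derivative, and $\eta_\alpha(t)=t^{\alpha-1}/\Gamma(\alpha)$. For vector fields put $\nabla\times\boldsymbol v=\partial_x v_2-\partial_y v_1$ in the weak sense, and let $H_0(\mathrm{curl};\Omega)$ be the space of $\boldsymbol v\in L^2(\Omega)^2$ with $\nabla\times\boldsymbol v\in L^2(\Omega)$ and vanishing tangential trace $\boldsymbol n\times\boldsymbol v=0$ on $\partial\Omega$. Let $\boldsymbol E\in C((0,T);H_0(\mathrm{curl};\Omega))$, and let $\boldsymbol E,\boldsymbol P$ (with values in $L^2(\Omega)^2$) and $H$ (with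 values in $L^2(\Omega)$) be continuous in time on $[0,T]$ and continuously differentiable in time on $(0,T)$. Suppose that for almost every $\boldsymbol x\in\Omega$ the function $\boldsymbol P(\boldsymbol x,\cdot)$ is absolutely continuous on $[0,T]$, i.e. $\partial_t\boldsymbol P(\boldsymbol x,\cdot)\in L^1(0,T)$, and $\partial_t^\alpha\boldsymbol P(\boldsymbol x,\cdot)$ extends continuously from $(0,T)$ to $[0,T]$; and that $\partial_t^\alpha\boldsymbol P(t)\in L^2(\Omega)^2$ for $t\in(0,T)$. Suppose that for every $t\in(0,T)$ $$\epsilon_0\epsilon_\infty(\partial_t\boldsymbol E,\boldsymbol\chi)+(\partial_t\boldsymbol P,\boldsymbol\chi)-(H,\nabla\times\boldsymbol\chi)=0\quad\forall\boldsymbol\chi\in H_0(\mathrm{curl};\Omega),$$ $$\mu_0(\partial_t H,\phi)+(\nabla\times\boldsymbol E,\phi)=0\quad\forall\phi\in L^2(\Omega),$$ $$\tau_0^\alpha(\partial_t^\alpha\boldsymbol P,\boldsymbol\psi)+(\boldsymbol P,\boldsymbol\psi)-\epsilon_0(\epsilon_s-\epsilon_\infty)(\boldsymbol E,\boldsymbol\psi)=0\quad\forall\boldsymbol\psi\in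 L^2(\Omega)^2.$$ Define $$\mathcal E_\alpha(t)=\tau_0^\alpha\,\mathcal I^\alpha\big(\|\partial_t^\alpha\boldsymbol P\|^2\big)(t)+\|\boldsymbol P(t)\|^2+\epsilon_0(\epsilon_s-\epsilon_\infty)\big(\epsilon_0\epsilon_\infty\|\boldsymbol E(t)\|^2+\mu_0\|H(t)\|^2\big).$$ Then $\mathcal E_\alpha$ is differentiable on $(0,T)$ and $$\frac{d}{dt}\mathcal E_\alpha(t)+\tau_0^\alpha\,\eta_\alpha(t)\,\|\partial_t^\alpha\boldsymbol P(t)\|^2\le 0\qquad\text{for all }t\in(0,T),$$ and consequently $\mathcal E_\alpha(t_1)\le\mathcal E_\alpha(t_2)$ whenever $0\le t_2\le t_1\le T$. -/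

import Mathlib

open MeasureTheory Set
open scoped ContDiff

noncomputable section

namespace ColeCole

/-- The plane `ℝ²` with its Euclidean norm. -/
abbrev Plane := EuclideanSpace ℝ (Fin 2)

/-- The open rectangle `(a,b) × (c,d)`. -/
def rectangle (a b c d : ℝ) : Set Plane :=
  {x | x 0 ∈ Ioo a b ∧ x 1 ∈ Ioo c d}

/-- The space `L²(Ω; F)`; its norm and inner product are the usual `L²(Ω)` ones. -/
abbrev L2 (Ω : Set Plane) (F : Type) [NormedAddCommGroup F] :=
  Lp F 2 (volume.restrict Ω)

open Classical in
/-- The class in `L²(Ω; F)` of a square integrable function (and `0` for any other function). -/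
def toL2 {F : Type} [NormedAddCommGroup F] (Ω : Set Plane) (f : Plane → F) : L2 Ω F :=
  if h : MemLp f 2 (volume.restrict Ω) then h.toLp f else 0

/-! ### The curl operators and `H₀(curl; Ω)` -/

/-- The vector curl `(∂φ/∂y, -∂φ/∂x)` of a scalar function. -/
def curlScalar (φ : Plane → ℝ) (x : Plane) : Plane :=
  !₂[fderiv ℝ φ x (EuclideanSpace.single 1 1), -fderiv ℝ φ x (EuclideanSpace.single 0 1)]

/-- `w = ∂v₂/∂x - ∂v₁/∂y` in the sense of distributions on `Ω`. -/
def IsWeakCurl (Ω : Set Plane) (v : Plane → Plane) (w : Plane → ℝ) : Prop :=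
  ∀ φ : Plane → ℝ, ContDiff ℝ ∞ φ → HasCompactSupport φ → tsupport φ ⊆ Ω →
    ∫ x in Ω, w x * φ x = ∫ x in Ω, inner ℝ (v x) (curlScalar φ x)

/-- `v ∈ H(curl; Ω)`: both `v` and its distributional curl are square integrable. -/
def MemHCurl (Ω : Set Plane) (v : Plane → Plane) : Prop :=
  MemLp v 2 (volume.restrict Ω) ∧
    ∃ w : Plane → ℝ, MemLp w 2 (volume.restrict Ω) ∧ IsWeakCurl Ω v w

open Classical in
/-- The (almost everywhere unique) square integrable weak curl of a field in `H(curl; Ω)`. -/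
def curl (Ω : Set Plane) (v : Plane → Plane) : Plane → ℝ :=
  if h : ∃ w : Plane → ℝ, MemLp w 2 (volume.restrict Ω) ∧ IsWeakCurl Ω v w then h.choose else 0

/-- `v ∈ H₀(curl; Ω)`. The tangential trace `n × v` of a field in `H(curl; Ω)` is the functional
`φ ↦ (curl v, φ) - (v, curl φ)`, and it is required to vanish; here `φ` ranges over the
restrictions to `Ω` of smooth compactly supported functions on the whole plane. -/
def MemH0Curl (Ω : Set Plane) (v : Plane → Plane) : Prop :=
  MemHCurl Ω v ∧
    ∀ φ : Plane → ℝ, ContDiff ℝ ∞ φ → HasCompactSupport φ →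
      ∫ x in Ω, curl Ω v x * φ x = ∫ x in Ω, inner ℝ (v x) (curlScalar φ x)

/-! ### Fractional calculus -/

/-- The Riemann-Liouville fractional integral of order `α`,
`(I^α u)(t) = Γ(α)⁻¹ ∫₀ᵗ (t - s)^(α - 1) u(s) ds`. -/
def fracIntegral {F : Type} [NormedAddCommGroup F] [NormedSpace ℝ F]
    (α : ℝ) (u : ℝ → F) (t : ℝ) : F :=
  (Real.Gamma α)⁻¹ • ∫ s in (0 : ℝ)..t, (t - s) ^ (α - 1) • u s

/-- The Caputo derivative of order `α`, `I^(1 - α) u'`. -/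
def caputo {F : Type} [NormedAddCommGroup F] [NormedSpace ℝ F]
    (α : ℝ) (u : ℝ → F) (t : ℝ) : F :=
  fracIntegral (1 - α) (deriv u) t

/-- `η_α(t) = t^(α - 1) / Γ(α)`. -/
def eta (α t : ℝ) : ℝ := t ^ (α - 1) / Real.Gamma α

/-- `u' ∈ L¹(0,T)`, that is, `u` is absolutely continuous on `[0,T]`: it is the integral of its
almost everywhere derivative. -/
def HasL1Deriv (T : ℝ) (u : ℝ → Plane) : Prop :=
  IntervalIntegrable (deriv u) volume 0 T ∧
    ∀ t ∈ Icc 0 T, u t = u 0 + ∫ s in (0 : ℝ)..t, deriv u s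

/-- `∂_t^α u ∈ C[0,T]`: the Caputo derivative on `(0,T)` extends continuously to `[0,T]`.
(The limit at `0` need not be `0`, as `u(t) = t ^ α` shows.) -/
def HasContCaputo (T α : ℝ) (u : ℝ → Plane) : Prop :=
  ∃ g : ℝ → Plane, ContinuousOn g (Icc 0 T) ∧ EqOn (caputo α u) g (Ioo 0 T)

/-- The field `x ↦ ∂_t^α P(x,t)`. -/
def caputoField (α : ℝ) (P : ℝ → Plane → Plane) (t : ℝ) : Plane → Plane :=
  fun x => caputo α (fun s => P s x) t

/-! ### The Cole-Cole model -/

/-- The material parameters: permittivities `ε₀`, `ε_∞`, `ε_s` with `ε_s > ε_∞`, permeability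
`μ₀` and relaxation time `τ₀`. -/
structure Medium where
  eps0 : ℝ
  epsInf : ℝ
  epsS : ℝ
  mu0 : ℝ
  tau0 : ℝ
  eps0_pos : 0 < eps0
  epsInf_pos : 0 < epsInf
  epsInf_lt_epsS : epsInf < epsS
  mu0_pos : 0 < mu0
  tau0_pos : 0 < tau0

/-- `u ∈ C([0,T]; L²(Ω)) ∩ C¹((0,T); L²(Ω))`. -/
structure IsC1L2 {F : Type} [NormedAddCommGroup F] [NormedSpace ℝ F]
    (Ω : Set Plane) (T : ℝ) (u : ℝ → Plane → F) : Prop where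
  memLp : ∀ t ∈ Icc 0 T, MemLp (u t) 2 (volume.restrict Ω)
  continuousOn : ContinuousOn (fun t => toL2 Ω (u t)) (Icc 0 T)
  contDiffOn : ContDiffOn ℝ 1 (fun t => toL2 Ω (u t)) (Ioo 0 T)

/-- The time derivative, in `L²(Ω)`, of a time dependent field. -/
def dt {F : Type} [NormedAddCommGroup F] [NormedSpace ℝ F]
    (Ω : Set Plane) (u : ℝ → Plane → F) (t : ℝ) : L2 Ω F :=
  deriv (fun s => toL2 Ω (u s)) t

/-- `(E, H, P)` is a weak solution on `Ω × (0,T)` of Maxwell's equations in the Cole-Cole medium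
`M` with exponent `α`. -/
structure IsWeakSolution (M : Medium) (α T : ℝ) (Ω : Set Plane)
    (E : ℝ → Plane → Plane) (H : ℝ → Plane → ℝ) (P : ℝ → Plane → Plane) : Prop where
  regE : IsC1L2 Ω T E
  regH : IsC1L2 Ω T H
  regP : IsC1L2 Ω T P
  memE : ∀ t ∈ Ioo 0 T, MemH0Curl Ω (E t)
  contCurlE : ContinuousOn (fun t => toL2 Ω (curl Ω (E t))) (Ioo 0 T)
  regPt : ∀ᵐ x ∂(volume.restrict Ω),
    HasL1Deriv T (fun t => P t x) ∧ HasContCaputo T α (fun t => P t x)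
  memCaputo : ∀ t ∈ Ioo 0 T, MemLp (caputoField α P t) 2 (volume.restrict Ω)
  ampere : ∀ t ∈ Ioo 0 T, ∀ χ : Plane → Plane, MemH0Curl Ω χ →
    M.eps0 * M.epsInf * inner ℝ (dt Ω E t) (toL2 Ω χ) + inner ℝ (dt Ω P t) (toL2 Ω χ)
      - inner ℝ (toL2 Ω (H t)) (toL2 Ω (curl Ω χ)) = 0
  faraday : ∀ t ∈ Ioo 0 T, ∀ φ : L2 Ω ℝ,
    M.mu0 * inner ℝ (dt Ω H t) φ + inner ℝ (toL2 Ω (curl Ω (E t))) φ = 0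
  polarization : ∀ t ∈ Ioo 0 T, ∀ ψ : L2 Ω Plane,
    M.tau0 ^ α * inner ℝ (toL2 Ω (caputoField α P t)) ψ + inner ℝ (toL2 Ω (P t)) ψ
      - M.eps0 * (M.epsS - M.epsInf) * inner ℝ (toL2 Ω (E t)) ψ = 0

/-- The modified energy
`τ₀^α I^α ‖∂_t^α P‖² + ‖P‖² + ε₀ (ε_s - ε_∞) (ε₀ ε_∞ ‖E‖² + μ₀ ‖H‖²)`. -/
def energy (M : Medium) (α : ℝ) (Ω : Set Plane)
    (E : ℝ → Plane → Plane) (H : ℝ → Plane → ℝ) (P : ℝ → Plane → Plane) (t : ℝ) : ℝ :=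
  M.tau0 ^ α * fracIntegral α (fun s => ‖toL2 Ω (caputoField α P s)‖ ^ 2) t
    + ‖toL2 Ω (P t)‖ ^ 2
    + M.eps0 * (M.epsS - M.epsInf) *
      (M.eps0 * M.epsInf * ‖toL2 Ω (E t)‖ ^ 2 + M.mu0 * ‖toL2 Ω (H t)‖ ^ 2)

end ColeCole

end

/-!
The polarization law identifies the Caputo derivative of `P` with an `L²(Ω)`-valued function `G`
that is continuous on `[0,T]` and `C¹` on `(0,T)`, and inverting the Caputo derivative gives
`I^α G = P - P(0)` in `L²(Ω)`. Fix `t`. The function `s ↦ ‖G s - G t‖²` is nonnegative and vanishes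
at `t`, so, the kernel being decreasing, the derivative of its fractional integral at `t` is
nonpositive. Expanding the square turns this into the fractional chain rule
`(I^α ‖G‖²)' + η_α ‖G‖² ≤ 2 (G, ∂_t P)`. Testing the polarization law with `∂_t P`, Ampère's law
with `E` and Faraday's law with `H` identifies `2 τ₀^α (G, ∂_t P)` with minus the derivative of the
remaining terms of the energy.
-/

namespace ColeCole

open Filter Topology Asymptotics

section ParametricIntegral

variable {F : Type*} [NormedAddCommGroup F] [NormedSpace ℝ F] {k : ℝ → ℝ} {p q : ℝ} {U : Set ℝ}

lemma continuousOn_integral_smul (hk : IntervalIntegrable k volume p q) (hU : IsCompact U)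
    {f : ℝ → ℝ → F} (hf : ContinuousOn f.uncurry (U ×ˢ uIcc p q)) :
    ContinuousOn (fun τ => ∫ s in p..q, k s • f τ s) U := by
  obtain ⟨C, hC⟩ := (hU.prod isCompact_uIcc).exists_bound_of_continuousOn hf
  have hleft : ∀ τ ∈ U, ContinuousOn (f τ) (uIcc p q) := fun τ hτ =>
    hf.comp (Continuous.prodMk_right τ).continuousOn fun s hs => ⟨hτ, hs⟩
  intro τ₀ hτ₀
  refine intervalIntegral.continuousWithinAt_of_dominated_interval
    (bound := fun s => ‖k s‖ * C) ?_ ?_ (hk.norm.mul_const C) ?_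
  · filter_upwards [self_mem_nhdsWithin] with τ hτ
    exact (hk.smul_continuousOn (hleft τ hτ)).aestronglyMeasurable_restrict_uIoc
  · filter_upwards [self_mem_nhdsWithin] with τ hτ
    refine Eventually.of_forall fun s hs => ?_
    rw [norm_smul]
    exact mul_le_mul_of_nonneg_left (hC (τ, s) ⟨hτ, uIoc_subset_uIcc hs⟩) (norm_nonneg _)
  · refine Eventually.of_forall fun s hs => ContinuousWithinAt.const_smul ?_ _
    exact (hf.comp (Continuous.prodMk_left s).continuousOn
      fun τ hτ => ⟨hτ, uIoc_subset_uIcc hs⟩) τ₀ hτ₀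

lemma differentiableAt_integral_smul (hk : IntervalIntegrable k volume p q) (hU : IsCompact U)
    {t : ℝ} (ht : U ∈ 𝓝 t) {f f' : ℝ → ℝ → F}
    (hf : ∀ τ ∈ U, ContinuousOn (f τ) (uIcc p q))
    (hff' : ∀ τ ∈ U, ∀ s ∈ uIcc p q, HasDerivAt (fun τ => f τ s) (f' τ s) τ)
    (hf' : ContinuousOn f'.uncurry (U ×ˢ uIcc p q)) :
    DifferentiableAt ℝ (fun τ => ∫ s in p..q, k s • f τ s) t := by
  obtain ⟨C, hC⟩ := (hU.prod isCompact_uIcc).exists_bound_of_continuousOn hf'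
  have hf't : ContinuousOn (f' t) (uIcc p q) :=
    hf'.comp (Continuous.prodMk_right t).continuousOn fun s hs => ⟨mem_of_mem_nhds ht, hs⟩
  refine (intervalIntegral.hasDerivAt_integral_of_dominated_loc_of_deriv_le
    (bound := fun s => ‖k s‖ * C) (F' := fun τ s => k s • f' τ s) ht ?_
    (hk.smul_continuousOn (hf t (mem_of_mem_nhds ht)))
    (hk.smul_continuousOn hf't).aestronglyMeasurable_restrict_uIoc ?_ (hk.norm.mul_const C)
    ?_).2.differentiableAt
  · filter_upwards [ht] with τ hτ
    exact (hk.smul_continuousOn (hf τ hτ)).aestronglyMeasurable_restrict_uIoc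
  · refine Eventually.of_forall fun s hs τ hτ => ?_
    rw [norm_smul]
    exact mul_le_mul_of_nonneg_left (hC (τ, s) ⟨hτ, uIoc_subset_uIcc hs⟩) (norm_nonneg _)
  · exact Eventually.of_forall fun s hs τ hτ => (hff' τ hτ s (uIoc_subset_uIcc hs)).const_smul (k s)

end ParametricIntegral

section Kernel

variable {F : Type*} [NormedAddCommGroup F] [NormedSpace ℝ F] {α β a b t : ℝ}

lemma intervalIntegrable_kernel (hα : 0 < α) (t a b : ℝ) :
    IntervalIntegrable (fun s => (t - s) ^ (α - 1)) volume a b := by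
  simpa using (intervalIntegral.intervalIntegrable_rpow' (a := t - a) (b := t - b)
    (r := α - 1) (by linarith)).comp_sub_left t

lemma intervalIntegrable_kernel_smul (hα : 0 < α) (t : ℝ) (hab : a ≤ b) {u : ℝ → F}
    (hu : ContinuousOn u (Icc a b)) :
    IntervalIntegrable (fun s => (t - s) ^ (α - 1) • u s) volume a b :=
  (intervalIntegrable_kernel hα t a b).smul_continuousOn (by rwa [uIcc_of_le hab])

lemma integral_kernel (hα : 0 < α) (a t : ℝ) :
    ∫ s in a..t, (t - s) ^ (α - 1) = (t - a) ^ α / α := by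
  rw [intervalIntegral.integral_comp_sub_left (fun x => x ^ (α - 1)), sub_self,
    integral_rpow (Or.inl (by linarith)), sub_add_cancel, Real.zero_rpow hα.ne', sub_zero]

lemma norm_integral_kernel_smul_le (hα : 0 < α) (hat : a ≤ t) {u : ℝ → F} {C : ℝ}
    (hu : ∀ s ∈ Ioc a t, ‖u s‖ ≤ C) :
    ‖∫ s in a..t, (t - s) ^ (α - 1) • u s‖ ≤ (t - a) ^ α / α * C := by
  rw [← integral_kernel hα, ← intervalIntegral.integral_mul_const]
  refine intervalIntegral.norm_integral_le_of_norm_le hat (Eventually.of_forall fun s hs => ?_)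
    ((intervalIntegrable_kernel hα t a t).mul_const C)
  have hker : 0 ≤ (t - s) ^ (α - 1) := Real.rpow_nonneg (sub_nonneg.2 hs.2) _
  rw [norm_smul, Real.norm_of_nonneg hker]
  exact mul_le_mul_of_nonneg_left (hu s hs) hker

-- Rescaling frees the singular kernel of its dependence on `t`, so one can differentiate in `t`
-- under the integral sign.
lemma integral_kernel_smul_eq_scaled (hα : 0 < α) (hat : a ≤ t) (u : ℝ → F) :
    ∫ s in a..t, (t - s) ^ (α - 1) • u s
      = (t - a) ^ α • ∫ σ in (0 : ℝ)..1, (1 - σ) ^ (α - 1) • u (a + (t - a) * σ) := by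
  have hscale := intervalIntegral.smul_integral_comp_add_mul (a := 0) (b := 1)
    (fun s => (t - s) ^ (α - 1) • u s) (t - a) a
  rw [mul_zero, add_zero, mul_one, add_sub_cancel] at hscale
  have hta : 0 ≤ t - a := sub_nonneg.2 hat
  have hpow : (t - a) ^ α = (t - a) * (t - a) ^ (α - 1) := by
    rw [← Real.rpow_one_add' hta (by linarith), add_sub_cancel]
  rw [← hscale, hpow, mul_smul, ← intervalIntegral.integral_smul ((t - a) ^ (α - 1))]
  congr 1
  refine intervalIntegral.integral_congr_Ioo_of_le zero_le_one fun σ hσ => ?_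
  simp only [smul_smul]
  rw [← Real.mul_rpow hta (by linarith [hσ.2])]
  congr 2
  ring

lemma integral_kernel_mul_kernel (hα : 0 < α) (hβ : 0 < β) (hat : a < t) :
    ∫ s in a..t, (t - s) ^ (α - 1) * (s - a) ^ (β - 1)
      = ProbabilityTheory.beta α β * (t - a) ^ (α + β - 1) := by
  have hscaled := Complex.betaIntegral_scaled β α (sub_pos.2 hat)
  have hreal : ∫ x in (0 : ℝ)..(t - a),
        (x : ℂ) ^ ((β : ℂ) - 1) * ((t - a : ℝ) - x : ℂ) ^ ((α : ℂ) - 1)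
      = ((∫ x in (0 : ℝ)..(t - a), (t - a - x) ^ (α - 1) * x ^ (β - 1) : ℝ) : ℂ) := by
    rw [← intervalIntegral.integral_ofReal]
    refine intervalIntegral.integral_congr_Ioo_of_le (sub_pos.2 hat).le fun x hx => ?_
    rw [Complex.ofReal_mul, Complex.ofReal_cpow hx.1.le, Complex.ofReal_cpow (sub_pos.2 hx.2).le,
      mul_comm]
    push_cast
    rfl
  have hshift := intervalIntegral.integral_comp_sub_right (a := a) (b := t)
    (fun x => (t - a - x) ^ (α - 1) * x ^ (β - 1)) a
  simp only [sub_self, sub_sub_sub_cancel_right] at hshift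
  have hbeta : Complex.betaIntegral β α = (ProbabilityTheory.beta α β : ℝ) := by
    rw [Complex.betaIntegral_eq_Gamma_mul_div _ _ (by simpa) (by simpa), ProbabilityTheory.beta,
      ← Complex.ofReal_add, Complex.Gamma_ofReal, Complex.Gamma_ofReal, Complex.Gamma_ofReal,
      mul_comm, add_comm]
    push_cast
    rfl
  rw [hshift]
  apply Complex.ofReal_injective
  rw [← hreal, hscaled, hbeta, mul_comm, Complex.ofReal_mul, Complex.ofReal_cpow (sub_pos.2 hat).le]
  push_cast
  rw [add_comm (β : ℂ)]

lemma intervalIntegrable_kernel_mul_kernel (hα : 0 < α) (hβ : 0 < β) (hat : a < t) :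
    IntervalIntegrable (fun s => (t - s) ^ (α - 1) * (s - a) ^ (β - 1)) volume a t := by
  refine intervalIntegral.intervalIntegrable_of_integral_ne_zero ?_
  rw [integral_kernel_mul_kernel hα hβ hat]
  exact (mul_pos (ProbabilityTheory.beta_pos hα hβ)
    (Real.rpow_pos_of_pos (sub_pos.2 hat) _)).ne'

end Kernel

section FracIntegral

variable {F : Type} [NormedAddCommGroup F] [NormedSpace ℝ F] {α β t T : ℝ} {u v : ℝ → F}

lemma fracIntegral_congr (ht : 0 ≤ t) (huv : EqOn u v (Ioo 0 t)) :
    fracIntegral α u t = fracIntegral α v t := by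
  unfold fracIntegral
  congr 1
  exact intervalIntegral.integral_congr_Ioo_of_le ht fun s hs => by simp only [huv hs]

lemma fracIntegral_one (u : ℝ → F) (t : ℝ) : fracIntegral 1 u t = ∫ s in (0 : ℝ)..t, u s := by
  simp [fracIntegral]

lemma fracIntegral_const [CompleteSpace F] (hα : 0 < α) (c : F) (t : ℝ) :
    fracIntegral α (fun _ => c) t = eta (α + 1) t • c := by
  rw [fracIntegral, intervalIntegral.integral_smul_const, integral_kernel hα, sub_zero, smul_smul,
    eta, Real.Gamma_add_one hα.ne', add_sub_cancel_right, inv_mul_eq_div, div_div]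

lemma hasDerivAt_eta_add_one (hα : 0 < α) (ht : 0 < t) :
    HasDerivAt (eta (α + 1)) (eta α t) t := by
  have hpow := (Real.hasDerivAt_rpow_const (p := α) (Or.inl ht.ne')).div_const (Real.Gamma (α + 1))
  rw [Real.Gamma_add_one hα.ne', mul_div_mul_left _ _ hα.ne'] at hpow
  refine hpow.congr_of_eventuallyEq (Eventually.of_forall fun τ => ?_)
  rw [eta, add_sub_cancel_right, Real.Gamma_add_one hα.ne']

lemma eta_nonneg (hα : 0 < α) (ht : 0 ≤ t) : 0 ≤ eta α t :=
  div_nonneg (Real.rpow_nonneg ht _) (Real.Gamma_pos_of_pos hα).le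

lemma fracIntegral_add (hα : 0 < α) (ht : 0 ≤ t) (hu : ContinuousOn u (Icc 0 t))
    (hv : ContinuousOn v (Icc 0 t)) :
    fracIntegral α (fun s => u s + v s) t = fracIntegral α u t + fracIntegral α v t := by
  simp only [fracIntegral, smul_add]
  rw [intervalIntegral.integral_add (intervalIntegrable_kernel_smul hα t ht hu)
    (intervalIntegrable_kernel_smul hα t ht hv), smul_add]

lemma fracIntegral_clm_apply {G : Type} [NormedAddCommGroup G] [NormedSpace ℝ G] [CompleteSpace F]
    [CompleteSpace G] (hα : 0 < α) (ht : 0 ≤ t) (hu : ContinuousOn u (Icc 0 t)) (L : F →L[ℝ] G) :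
    fracIntegral α (fun s => L (u s)) t = L (fracIntegral α u t) := by
  simp only [fracIntegral, map_smul,
    ← L.intervalIntegral_comp_comm (intervalIntegrable_kernel_smul hα t ht hu)]

lemma fracIntegral_eq_history_add_recent (hα : 0 < α) {a τ : ℝ} (ha : 0 ≤ a) (haτ : a ≤ τ)
    (hu : ContinuousOn u (Icc 0 τ)) :
    fracIntegral α u τ = (Real.Gamma α)⁻¹ • ((∫ s in (0 : ℝ)..a, (τ - s) ^ (α - 1) • u s)
      + ∫ s in a..τ, (τ - s) ^ (α - 1) • u s) := by
  rw [fracIntegral, intervalIntegral.integral_add_adjacent_intervals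
    (intervalIntegrable_kernel_smul hα τ ha (hu.mono (Icc_subset_Icc_right haτ)))
    (intervalIntegrable_kernel_smul hα τ haτ (hu.mono (Icc_subset_Icc_left ha)))]

lemma continuousOn_fracIntegral (hα : 0 < α) (hu : ContinuousOn u (Icc 0 T)) :
    ContinuousOn (fracIntegral α u) (Icc 0 T) := by
  have hscaled : ContinuousOn
      (fun t => ∫ σ in (0 : ℝ)..1, (1 - σ) ^ (α - 1) • u (0 + (t - 0) * σ)) (Icc 0 T) := by
    refine continuousOn_integral_smul (intervalIntegrable_kernel hα 1 0 1) isCompact_Icc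
      (f := fun t σ => u (0 + (t - 0) * σ)) (hu.comp (by fun_prop) ?_)
    rintro ⟨t, σ⟩ ⟨ht, hσ⟩
    rw [uIcc_of_le zero_le_one] at hσ
    simp only [sub_zero, zero_add]
    exact ⟨mul_nonneg ht.1 hσ.1, (mul_le_of_le_one_right ht.1 hσ.2).trans ht.2⟩
  have hpow : ContinuousOn (fun t : ℝ => (t - 0) ^ α) (Icc 0 T) :=
    ((continuous_sub_right 0).rpow_const fun _ => Or.inr hα.le).continuousOn
  refine ((hpow.smul hscaled).const_smul (Real.Gamma α)⁻¹).congr fun t ht => ?_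
  simp only [fracIntegral, integral_kernel_smul_eq_scaled hα ht.1]
  rfl

end FracIntegral

section Semigroup

section Triangle

variable {F : Type*} [NormedAddCommGroup F] [NormedSpace ℝ F] {a b : ℝ} {f : ℝ → ℝ → F}

lemma setIntegral_indicator_Ioi {g : ℝ → F} {r : ℝ} (hr : r ∈ Ioc a b) :
    ∫ s in Ioc a b, (Ioi r).indicator g s = ∫ s in r..b, g s := by
  rw [setIntegral_indicator measurableSet_Ioi, Ioc_inter_Ioi, max_eq_right hr.1.le,
    intervalIntegral.integral_of_le hr.2]

lemma setIntegral_indicator_Iio {g : ℝ → F} {s : ℝ} (hs : s ∈ Ioc a b) :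
    ∫ r in Ioc a b, (Iio s).indicator g r = ∫ r in a..s, g r := by
  have hslice : Ioc a b ∩ Iio s = Ioo a s :=
    Set.ext fun r => ⟨fun h => ⟨h.1.1, h.2⟩, fun h => ⟨⟨h.1, h.2.le.trans hs.2⟩, h.2⟩⟩
  rw [setIntegral_indicator measurableSet_Iio, hslice, intervalIntegral.integral_of_le hs.1.le,
    integral_Ioc_eq_integral_Ioo]

lemma integrable_indicator_triangle {E : Type*} [NormedAddCommGroup E] {f : ℝ → ℝ → E}
    (hab : a ≤ b)
    (hmeas : AEStronglyMeasurable f.uncurry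
      ((volume.restrict (Ioc a b)).prod (volume.restrict (Ioc a b))))
    (hcol : ∀ r ∈ Ioo a b, IntervalIntegrable (fun s => f s r) volume r b)
    (hnorm : IntervalIntegrable (fun r => ∫ s in r..b, ‖f s r‖) volume a b) :
    Integrable ({z : ℝ × ℝ | z.2 < z.1}.indicator f.uncurry)
      ((volume.restrict (Ioc a b)).prod (volume.restrict (Ioc a b))) := by
  have hmem : ∀ᵐ r ∂volume.restrict (Ioc a b), r ∈ Ioo a b := by
    rw [← restrict_Ioo_eq_restrict_Ioc]
    exact ae_restrict_mem measurableSet_Ioo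
  rw [integrable_prod_iff' (hmeas.indicator (measurableSet_lt measurable_snd measurable_fst))]
  constructor
  · filter_upwards [hmem] with r hr
    have hslice : Ioi r ∩ Ioc a b = Ioc r b := by
      rw [inter_comm, Ioc_inter_Ioi, max_eq_right hr.1.le]
    have hint := (intervalIntegrable_iff_integrableOn_Ioc_of_le hr.2.le).1 (hcol r hr)
    rw [← hslice, IntegrableOn, ← Measure.restrict_restrict measurableSet_Ioi] at hint
    exact IntegrableOn.integrable_indicator hint measurableSet_Ioi
  · refine ((intervalIntegrable_iff_integrableOn_Ioc_of_le hab).1 hnorm).congr ?_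
    filter_upwards [hmem] with r hr
    rw [← setIntegral_indicator_Ioi (Ioo_subset_Ioc_self hr)]
    simp only [norm_indicator_eq_indicator_norm]
    rfl

lemma intervalIntegral_swap_triangle (hab : a ≤ b)
    (hf : Integrable ({z : ℝ × ℝ | z.2 < z.1}.indicator f.uncurry)
      ((volume.restrict (Ioc a b)).prod (volume.restrict (Ioc a b)))) :
    ∫ s in a..b, ∫ r in a..s, f s r = ∫ r in a..b, ∫ s in r..b, f s r := by
  rw [intervalIntegral.integral_of_le hab, intervalIntegral.integral_of_le hab,
    setIntegral_congr_fun measurableSet_Ioc fun s hs => (setIntegral_indicator_Iio hs).symm,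
    setIntegral_congr_fun measurableSet_Ioc fun r hr => (setIntegral_indicator_Ioi hr).symm]
  exact integral_integral_swap hf

end Triangle

variable {F : Type} [NormedAddCommGroup F] [NormedSpace ℝ F] {α β t : ℝ} {f : ℝ → F}

lemma integrable_indicator_kernel_mul_kernel_smul (hα : 0 < α) (hβ : 0 < β) (hαβ : 1 ≤ α + β)
    (ht : 0 ≤ t) (hf : IntervalIntegrable f volume 0 t) :
    Integrable ({z : ℝ × ℝ | z.2 < z.1}.indicator
        (fun s r => ((t - s) ^ (α - 1) * (s - r) ^ (β - 1)) • f r).uncurry)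
      ((volume.restrict (Ioc 0 t)).prod (volume.restrict (Ioc 0 t))) := by
  refine integrable_indicator_triangle ht ?_ ?_ ?_
  · have hker : Measurable fun z : ℝ × ℝ => (t - z.1) ^ (α - 1) * (z.1 - z.2) ^ (β - 1) := by
      fun_prop
    exact hker.aestronglyMeasurable.smul
      ((intervalIntegrable_iff_integrableOn_Ioc_of_le ht).1 hf).aestronglyMeasurable.comp_snd
  · exact fun r hr => (intervalIntegrable_kernel_mul_kernel hα hβ hr.2).smul_continuousOn
      continuousOn_const
  · have hpow : Continuous fun r => (t - r) ^ (α + β - 1) :=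
      (continuous_const.sub continuous_id).rpow_const fun _ => Or.inr (by linarith)
    refine ((hf.norm.continuousOn_mul hpow.continuousOn).const_mul
      (ProbabilityTheory.beta α β)).congr_uIoo fun r hr => ?_
    rw [uIoo_of_le ht] at hr
    symm
    calc ∫ s in r..t, ‖((t - s) ^ (α - 1) * (s - r) ^ (β - 1)) • f r‖
        = ∫ s in r..t, (t - s) ^ (α - 1) * (s - r) ^ (β - 1) * ‖f r‖ := by
          refine intervalIntegral.integral_congr_Ioo_of_le hr.2.le fun s hs => ?_
          rw [norm_smul, Real.norm_of_nonneg (mul_nonneg (Real.rpow_nonneg (sub_pos.2 hs.2).le _)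
            (Real.rpow_nonneg (sub_pos.2 hs.1).le _))]
      _ = ProbabilityTheory.beta α β * ((t - r) ^ (α + β - 1) * ‖f r‖) := by
          rw [intervalIntegral.integral_mul_const, integral_kernel_mul_kernel hα hβ hr.2, mul_assoc]

lemma fracIntegral_fracIntegral [CompleteSpace F] (hα : 0 < α) (hβ : 0 < β) (hαβ : 1 ≤ α + β)
    (ht : 0 ≤ t) (hf : IntervalIntegrable f volume 0 t) :
    fracIntegral α (fracIntegral β f) t = fracIntegral (α + β) f t := by
  have hinner : ∀ r ∈ Ioo 0 t, ∫ s in r..t, ((t - s) ^ (α - 1) * (s - r) ^ (β - 1)) • f r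
      = ProbabilityTheory.beta α β • (t - r) ^ (α + β - 1) • f r := fun r hr => by
    rw [intervalIntegral.integral_smul_const, integral_kernel_mul_kernel hα hβ hr.2, mul_smul]
  have hswap : ∫ s in (0 : ℝ)..t, (t - s) ^ (α - 1) • ∫ r in (0 : ℝ)..s, (s - r) ^ (β - 1) • f r
      = ProbabilityTheory.beta α β • ∫ r in (0 : ℝ)..t, (t - r) ^ (α + β - 1) • f r := by
    simp only [← intervalIntegral.integral_smul, smul_smul]
    rw [intervalIntegral_swap_triangle ht
      (integrable_indicator_kernel_mul_kernel_smul hα hβ hαβ ht hf)]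
    simp only [← smul_smul (ProbabilityTheory.beta α β)]
    exact intervalIntegral.integral_congr_Ioo_of_le ht hinner
  have hΓα := (Real.Gamma_pos_of_pos hα).ne'
  have hΓβ := (Real.Gamma_pos_of_pos hβ).ne'
  have hpull : ∀ s, (t - s) ^ (α - 1) • fracIntegral β f s
      = (Real.Gamma β)⁻¹ • (t - s) ^ (α - 1) • ∫ r in (0 : ℝ)..s, (s - r) ^ (β - 1) • f r :=
    fun s => smul_comm ..
  have hΓ : (Real.Gamma α)⁻¹ * ((Real.Gamma β)⁻¹ * ProbabilityTheory.beta α β)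
      = (Real.Gamma (α + β))⁻¹ := by
    rw [ProbabilityTheory.beta]
    field_simp
  rw [fracIntegral, intervalIntegral.integral_congr fun s _ => hpull s,
    intervalIntegral.integral_smul, hswap, smul_smul (Real.Gamma β)⁻¹, smul_smul, hΓ, fracIntegral]

lemma fracIntegral_caputo [CompleteSpace F] (hα₀ : 0 < α) (hα₁ : α < 1) (ht : 0 ≤ t)
    {u : ℝ → F} (hu : IntervalIntegrable (deriv u) volume 0 t) :
    fracIntegral α (caputo α u) t = ∫ r in (0 : ℝ)..t, deriv u r := by
  have hsum : α + (1 - α) = 1 := add_sub_cancel α 1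
  have hcomp := fracIntegral_fracIntegral hα₀ (sub_pos.2 hα₁) hsum.ge ht hu
  rwa [hsum, fracIntegral_one] at hcomp

lemma HasL1Deriv.fracIntegral_caputo {T : ℝ} {u : ℝ → Plane} (hu : HasL1Deriv T u) (hα₀ : 0 < α)
    (hα₁ : α < 1) (ht : t ∈ Icc 0 T) : fracIntegral α (caputo α u) t = u t - u 0 := by
  have hsub : uIcc 0 t ⊆ uIcc 0 T := by
    rw [uIcc_of_le ht.1, uIcc_of_le (ht.1.trans ht.2)]
    exact Icc_subset_Icc_right ht.2
  rw [ColeCole.fracIntegral_caputo hα₀ hα₁ ht.1 (hu.1.mono_set hsub)]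
  exact eq_sub_of_add_eq' (hu.2 t ht).symm

end Semigroup

section Differentiability

variable {F : Type} [NormedAddCommGroup F] [NormedSpace ℝ F] {α a b t T : ℝ}

lemma differentiableAt_integral_rpow_smul_of_lt {u : ℝ → F} (hab : a ≤ b) (hbt : b < t)
    (hu : ContinuousOn u (Icc a b)) (β : ℝ) :
    DifferentiableAt ℝ (fun τ => ∫ s in a..b, (τ - s) ^ β • u s) t := by
  have hU : Icc ((b + t) / 2) (t + 1) ∈ 𝓝 t := Icc_mem_nhds (by linarith) (by linarith)
  have hpos : ∀ τ ∈ Icc ((b + t) / 2) (t + 1), ∀ s ∈ Icc a b, τ - s ≠ 0 := fun τ hτ s hs => by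
    linarith [hτ.1, hs.2]
  have key := differentiableAt_integral_smul (k := 1) (p := a) (q := b)
    (f := fun τ s => (τ - s) ^ β • u s) (f' := fun τ s => (1 * β * (τ - s) ^ (β - 1)) • u s)
    intervalIntegrable_const isCompact_Icc hU
  rw [uIcc_of_le hab] at key
  simp only [Pi.one_apply, one_smul] at key
  refine key (fun τ hτ => ?_) (fun τ hτ s hs => ?_) ?_
  · exact ((continuousOn_const.sub continuousOn_id).rpow_const
      fun s hs => Or.inl (hpos τ hτ s hs)).smul hu
  · exact (((hasDerivAt_id τ).sub_const s).rpow_const (Or.inl (hpos τ hτ s hs))).smul_const (u s)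
  · refine ContinuousOn.smul (continuousOn_const.mul (ContinuousOn.rpow_const (by fun_prop)
      fun z hz => Or.inl (hpos z.1 hz.1 z.2 hz.2))) (hu.comp continuousOn_snd fun z hz => hz.2)

lemma differentiableAt_integral_kernel_smul {w : ℝ → F} (hα : 0 < α) (ht : t ∈ Ioo a b)
    (hw : ∀ s ∈ Icc a b, ContDiffAt ℝ 1 w s) :
    DifferentiableAt ℝ (fun τ => ∫ s in a..τ, (τ - s) ^ (α - 1) • w s) t := by
  have hmaps : MapsTo (fun z : ℝ × ℝ => a + (z.1 - a) * z.2) (Icc a b ×ˢ Icc 0 1) (Icc a b) := by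
    rintro ⟨τ, σ⟩ ⟨hτ, hσ⟩
    have hτa : 0 ≤ τ - a := sub_nonneg.2 hτ.1
    exact ⟨le_add_of_nonneg_right (mul_nonneg hτa hσ.1),
      by linarith [mul_le_of_le_one_right hτa hσ.2, hτ.2]⟩
  have hwc : ContinuousOn w (Icc a b) := fun s hs => (hw s hs).continuousAt.continuousWithinAt
  have hw' : ContinuousOn (deriv w) (Icc a b) := fun s hs =>
    (((hw s hs).continuousAt_fderiv one_ne_zero).clm_apply
      continuousAt_const).continuousWithinAt
  have hscaled := differentiableAt_integral_smul (p := 0) (q := 1)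
    (f := fun τ σ => w (a + (τ - a) * σ)) (f' := fun τ σ => σ • deriv w (a + (τ - a) * σ))
    (intervalIntegrable_kernel hα 1 0 1) isCompact_Icc (Icc_mem_nhds ht.1 ht.2)
  rw [uIcc_of_le zero_le_one] at hscaled
  have hdiff := hscaled
    (fun τ hτ => hwc.comp (by fun_prop) fun σ hσ => hmaps (mk_mem_prod hτ hσ))
    (fun τ hτ σ hσ => by
      have hinner : HasDerivAt (fun τ : ℝ => a + (τ - a) * σ) σ τ := by
        simpa using (((hasDerivAt_id τ).sub_const a).mul_const σ).const_add a
      exact ((hw _ (hmaps (mk_mem_prod hτ hσ))).differentiableAt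
        one_ne_zero).hasDerivAt.scomp τ hinner)
    (continuousOn_snd.smul (hw'.comp (by fun_prop) hmaps))
  have hpow : DifferentiableAt ℝ (fun τ => (τ - a) ^ α) t :=
    (differentiableAt_id.sub_const a).rpow_const (Or.inl (sub_pos.2 ht.1).ne')
  refine (hpow.smul hdiff).congr_of_eventuallyEq ?_
  filter_upwards [Ioi_mem_nhds ht.1] with τ hτ
  exact integral_kernel_smul_eq_scaled hα hτ.le w

lemma differentiableAt_fracIntegral {w : ℝ → F} (hα : 0 < α) (hw : ContinuousOn w (Icc 0 T))
    (ht : t ∈ Ioo 0 T) (hwt : ContDiffAt ℝ 1 w t) : DifferentiableAt ℝ (fracIntegral α w) t := by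
  obtain ⟨a, b, -, hnhds, hab⟩ := exists_Icc_mem_subset_of_mem_nhds
    ((hwt.eventually (by decide)).and (Ioo_mem_nhds ht.1 ht.2))
  obtain ⟨hat, htb⟩ := Icc_mem_nhds_iff.1 hnhds
  have ha : 0 ≤ a := (hab (left_mem_Icc.2 (hat.trans htb).le)).2.1.le
  have hsub : Icc 0 a ⊆ Icc 0 T := Icc_subset_Icc_right (hat.trans ht.2).le
  refine (((differentiableAt_integral_rpow_smul_of_lt ha hat (hw.mono hsub) (α - 1)).add
    (differentiableAt_integral_kernel_smul hα ⟨hat, htb⟩ fun s hs => (hab hs).1)).const_smul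
      (Real.Gamma α)⁻¹).congr_of_eventuallyEq ?_
  filter_upwards [Ioo_mem_nhds hat ht.2] with τ hτ
  exact fracIntegral_eq_history_add_recent hα ha hτ.1.le
    (hw.mono (Icc_subset_Icc_right hτ.2.le))

end Differentiability

section Inequality

variable {F : Type} [NormedAddCommGroup F] [NormedSpace ℝ F] {α t T : ℝ}

lemma antitoneOn_integral_kernel_smul {q : ℝ → ℝ} (hα₀ : 0 < α) (hα₁ : α ≤ 1) (ht : 0 ≤ t)
    (hq : ContinuousOn q (Icc 0 t)) (hq₀ : ∀ s ∈ Icc 0 t, 0 ≤ q s) :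
    AntitoneOn (fun τ => ∫ s in (0 : ℝ)..t, (τ - s) ^ (α - 1) • q s) (Ici t) := by
  intro τ₁ hτ₁ τ₂ _ hτ
  refine intervalIntegral.integral_mono_on_of_le_Ioo ht
    (intervalIntegrable_kernel_smul hα₀ τ₂ ht hq) (intervalIntegrable_kernel_smul hα₀ τ₁ ht hq)
    fun s hs => ?_
  refine mul_le_mul_of_nonneg_right (Real.rpow_le_rpow_of_nonpos ?_ (by linarith) (by linarith))
    (hq₀ s (Ioo_subset_Icc_self hs))
  exact sub_pos.2 (hs.2.trans_le hτ₁)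

lemma isLittleO_integral_kernel_smul {u : ℝ → F} (hα : 0 < α) (hut : u t = 0)
    (hu : DifferentiableAt ℝ u t) :
    (fun τ => ∫ s in t..τ, (τ - s) ^ (α - 1) • u s) =o[𝓝[>] t] fun τ => τ - t := by
  obtain ⟨C, hC₀, hC⟩ := hu.isBigO_sub.exists_nonneg
  simp only [hut, sub_zero] at hC
  obtain ⟨b, hb, hCb⟩ := mem_nhdsGT_iff_exists_Ioc_subset.1 (mem_nhdsWithin_of_mem_nhds hC.bound)
  have hbound : (fun τ => ∫ s in t..τ, (τ - s) ^ (α - 1) • u s)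
      =O[𝓝[>] t] fun τ => (τ - t) ^ α * (τ - t) := by
    refine IsBigO.of_bound (C / α) ?_
    filter_upwards [Ioc_mem_nhdsGT hb] with τ hτ
    have hτt : 0 ≤ τ - t := sub_nonneg.2 hτ.1.le
    refine (norm_integral_kernel_smul_le hα hτ.1.le (C := C * (τ - t)) fun s hs => ?_).trans_eq ?_
    · refine (hCb (Ioc_subset_Ioc_right hτ.2 hs)).trans (mul_le_mul_of_nonneg_left ?_ hC₀)
      rw [Real.norm_of_nonneg (sub_nonneg.2 hs.1.le)]
      exact sub_le_sub_right hs.2 t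
    · rw [Real.norm_of_nonneg (mul_nonneg (Real.rpow_nonneg hτt α) hτt)]
      ring
  have hpow : Tendsto (fun τ => (τ - t) ^ α) (𝓝[>] t) (𝓝 0) := by
    have hcont : Continuous fun τ : ℝ => (τ - t) ^ α :=
      (continuous_sub_right t).rpow_const fun _ => Or.inr hα.le
    simpa [hα.ne'] using (hcont.tendsto t).mono_left nhdsWithin_le_nhds
  simpa using hbound.trans_isLittleO
    (((isLittleO_one_iff ℝ).2 hpow).mul_isBigO (isBigO_refl (fun τ => τ - t) _))

lemma deriv_fracIntegral_nonpos_of_eq_zero {q : ℝ → ℝ} {D : ℝ} (hα₀ : 0 < α) (hα₁ : α ≤ 1)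
    (hq : ContinuousOn q (Icc 0 T)) (hq₀ : ∀ s ∈ Icc 0 T, 0 ≤ q s) (ht : t ∈ Ioo 0 T)
    (hqt : q t = 0) (hqd : DifferentiableAt ℝ q t) (hD : HasDerivAt (fracIntegral α q) D t) :
    D ≤ 0 := by
  have hsub : Icc 0 t ⊆ Icc 0 T := Icc_subset_Icc_right ht.2.le
  have hslope : Tendsto (slope (fracIntegral α q) t) (𝓝[>] t) (𝓝 D) :=
    (hasDerivAt_iff_tendsto_slope.1 hD).mono_left (nhdsWithin_mono _ fun s hs => ne_of_gt hs)
  have hrecent := (isLittleO_integral_kernel_smul hα₀ hqt hqd).tendsto_div_nhds_zero.const_mul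
    (Real.Gamma α)⁻¹
  rw [mul_zero] at hrecent
  refine le_of_tendsto_of_tendsto hslope hrecent ?_
  filter_upwards [Ioo_mem_nhdsGT ht.2] with τ hτ
  have hhistory := antitoneOn_integral_kernel_smul hα₀ hα₁ ht.1.le (hq.mono hsub)
    (fun s hs => hq₀ s (hsub hs)) self_mem_Ici hτ.1.le hτ.1.le
  rw [slope_def_field, fracIntegral_eq_history_add_recent hα₀ ht.1.le hτ.1.le
    (hq.mono (Icc_subset_Icc_right hτ.2.le)), fracIntegral, ← smul_sub, smul_eq_mul, mul_div_assoc]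
  gcongr
  · exact sub_nonneg.2 hτ.1.le
  · beta_reduce at hhistory
    linarith

variable {X : Type} [NormedAddCommGroup X] [InnerProductSpace ℝ X] [CompleteSpace X] {G : ℝ → X}

lemma fracIntegral_norm_sub_sq (hα : 0 < α) (ht : 0 ≤ t) (hG : ContinuousOn G (Icc 0 t)) (x : X) :
    fracIntegral α (fun s => ‖G s - x‖ ^ 2) t
      = fracIntegral α (fun s => ‖G s‖ ^ 2) t + (-2 * inner ℝ x (fracIntegral α G t)
        + eta (α + 1) t * ‖x‖ ^ 2) := by
  let L : X →L[ℝ] ℝ := (-2 : ℝ) • innerSL ℝ x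
  have hexpand : (fun s => ‖G s - x‖ ^ 2) = fun s => ‖G s‖ ^ 2 + (L (G s) + ‖x‖ ^ 2) := by
    ext s
    simp only [L, smul_apply, innerSL_apply_apply, smul_eq_mul]
    rw [norm_sub_sq_real, real_inner_comm]
    ring
  have hL : ContinuousOn (fun s => L (G s)) (Icc 0 t) := L.continuous.comp_continuousOn hG
  have hconst : ContinuousOn (fun _ : ℝ => ‖x‖ ^ 2) (Icc 0 t) := continuousOn_const
  rw [hexpand, fracIntegral_add (u := fun s => ‖G s‖ ^ 2) (v := fun s => L (G s) + ‖x‖ ^ 2) hα ht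
    (hG.norm.pow 2) (hL.add hconst), fracIntegral_add hα ht hL hconst,
    fracIntegral_clm_apply hα ht hG, fracIntegral_const hα]
  rfl

lemma deriv_fracIntegral_norm_sq_add_le (hα₀ : 0 < α) (hα₁ : α ≤ 1)
    (hG : ContinuousOn G (Icc 0 T)) (ht : t ∈ Ioo 0 T) (hGt : ContDiffAt ℝ 1 G t) {v : X}
    (hv : HasDerivAt (fracIntegral α G) v t) :
    deriv (fracIntegral α fun s => ‖G s‖ ^ 2) t + eta α t * ‖G t‖ ^ 2 ≤ 2 * inner ℝ (G t) v := by
  have hsq := (differentiableAt_fracIntegral hα₀ (hG.norm.pow 2) ht (hGt.norm_sq ℝ)).hasDerivAt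
  have hinner := ((innerSL ℝ (G t)).hasFDerivAt.comp_hasDerivAt t hv).const_mul (-2)
  have heta := (hasDerivAt_eta_add_one hα₀ ht.1).mul_const (‖G t‖ ^ 2)
  have hdist : HasDerivAt (fracIntegral α fun s => ‖G s - G t‖ ^ 2)
      (deriv (fracIntegral α fun s => ‖G s‖ ^ 2) t
        + (-2 * inner ℝ (G t) v + eta α t * ‖G t‖ ^ 2)) t := by
    refine (hsq.add (hinner.add heta)).congr_of_eventuallyEq ?_
    filter_upwards [Ioo_mem_nhds ht.1 ht.2] with τ hτ
    exact fracIntegral_norm_sub_sq hα₀ hτ.1.le (hG.mono (Icc_subset_Icc_right hτ.2.le)) (G t)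
  have hGd : DifferentiableAt ℝ (fun s => ‖G s - G t‖ ^ 2) t :=
    ((hGt.differentiableAt one_ne_zero).sub_const _).norm_sq ℝ
  have hle := deriv_fracIntegral_nonpos_of_eq_zero hα₀ hα₁
    ((hG.sub continuousOn_const).norm.pow 2) (fun s _ => sq_nonneg _) ht (by simp) hGd hdist
  linarith

end Inequality

section LpIntegral

open scoped ENNReal

variable {Y : Type*} [MeasurableSpace Y] {ν : Measure Y} {k : Y → ℝ}

lemma integral_smul_comp_simpleFunc {F Z : Type*} [NormedAddCommGroup F] [NormedSpace ℝ F]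
    [CompleteSpace F] (hk : Integrable k ν) (p : SimpleFunc Y Z) (f : Z → F) :
    ∫ y, k y • f (p y) ∂ν = ∑ z ∈ p.range, (∫ y in p ⁻¹' {z}, k y ∂ν) • f z := by
  classical
  have hsplit : ∀ y, k y • f (p y) = ∑ z ∈ p.range, (p ⁻¹' {z}).indicator k y • f z := fun y => by
    rw [Finset.sum_eq_single_of_mem (p y) (p.mem_range_self y) fun z _ hz => by
      rw [indicator_of_notMem (fun h => hz h.symm), zero_smul]]
    rw [indicator_of_mem (mem_preimage.2 (mem_singleton (p y)))]
  simp only [hsplit]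
  rw [integral_finsetSum _ fun z _ =>
    (hk.indicator (p.measurableSet_fiber z)).smul_const (f z)]
  simp only [integral_smul_const, integral_indicator (p.measurableSet_fiber _)]

lemma coeFn_integral_smul_comp_simpleFunc {X F Z : Type*} [MeasurableSpace X] {μ : Measure X}
    [NormedAddCommGroup F] [NormedSpace ℝ F] [CompleteSpace F] {q : ℝ≥0∞} [Fact (1 ≤ q)]
    (hk : Integrable k ν) (p : SimpleFunc Y Z) {G : Z → Lp F q μ} {g : Z → X → F}
    (hGg : ∀ z ∈ p.range, G z =ᵐ[μ] g z) :
    (∫ y, k y • G (p y) ∂ν : Lp F q μ) =ᵐ[μ] fun x => ∫ y, k y • g (p y) x ∂ν := by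
  rw [integral_smul_comp_simpleFunc hk]
  have hterm : ∀ᵐ x ∂μ, ∀ z ∈ p.range,
      ((∫ y in p ⁻¹' {z}, k y ∂ν) • G z : Lp F q μ) x = (∫ y in p ⁻¹' {z}, k y ∂ν) • g z x := by
    refine (Finset.eventually_all _).2 fun z hz => ?_
    filter_upwards [Lp.coeFn_smul (∫ y in p ⁻¹' {z}, k y ∂ν) (G z), hGg z hz] with x hsmul hx
    rw [hsmul, Pi.smul_apply, hx]
  filter_upwards [Lp.coeFn_finsetSum p.range fun z => (∫ y in p ⁻¹' {z}, k y ∂ν) • G z, hterm]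
    with x hsum hx
  rw [hsum, Finset.sum_apply, Finset.sum_congr rfl hx,
    integral_smul_comp_simpleFunc hk p fun z => g z x]

lemma tendsto_integral_smul_comp_simpleFunc {F : Type*} [NormedAddCommGroup F] [NormedSpace ℝ F]
    [TopologicalSpace Y] {K : Set Y} (hK : IsCompact K) (hk : Integrable k ν) {f : Y → F}
    (hf : ContinuousOn f K) {p : ℕ → SimpleFunc Y Y} (hpK : ∀ n y, p n y ∈ K)
    (hp : ∀ᵐ y ∂ν, y ∈ K ∧ Tendsto (fun n => p n y) atTop (𝓝 y)) :
    Tendsto (fun n => ∫ y, k y • f (p n y) ∂ν) atTop (𝓝 (∫ y, k y • f y ∂ν)) := by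
  obtain ⟨C, hC⟩ := hK.exists_bound_of_continuousOn hf
  refine tendsto_integral_of_dominated_convergence (fun y => ‖k y‖ * C)
    (fun n => hk.aestronglyMeasurable.smul ((p n).map f).aestronglyMeasurable)
    (hk.norm.mul_const C) (fun n => Eventually.of_forall fun y => ?_) ?_
  · rw [norm_smul]
    exact mul_le_mul_of_nonneg_left (hC _ (hpK n y)) (norm_nonneg _)
  · filter_upwards [hp] with y hy
    exact ((hf y hy.1).tendsto.comp (tendsto_nhdsWithin_iff.2
      ⟨hy.2, Eventually.of_forall fun n => hpK n y⟩)).const_smul (k y)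

-- Joint measurability of `g` is not assumed, so Fubini is unavailable; instead both integrals are
-- limits of the same finite sums, whose nodes do not depend on `x`.
lemma coeFn_integral_smul {X F : Type*} [MeasurableSpace X] {μ : Measure X}
    [NormedAddCommGroup F] [NormedSpace ℝ F] [CompleteSpace F] {q : ℝ≥0∞} [Fact (1 ≤ q)]
    [PseudoEMetricSpace Y] [OpensMeasurableSpace Y] [TopologicalSpace.SeparableSpace Y]
    {D K : Set Y} (hD : D.Nonempty) (hDK : D ⊆ K) (hK : IsCompact K) (hDν : ∀ᵐ y ∂ν, y ∈ D)
    (hk : Integrable k ν) {G : Y → Lp F q μ} (hG : ContinuousOn G K) {g : Y → X → F}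
    (hGg : ∀ y ∈ D, G y =ᵐ[μ] g y)
    (hg : ∀ᵐ x ∂μ, ∃ h : Y → F, ContinuousOn h K ∧ EqOn (fun y => g y x) h D) :
    (∫ y, k y • G y ∂ν : Lp F q μ) =ᵐ[μ] fun x => ∫ y, k y • g y x ∂ν := by
  obtain ⟨y₀, hy₀⟩ := hD
  let p := SimpleFunc.approxOn id measurable_id D y₀ hy₀
  have hpD : ∀ n y, p n y ∈ D := SimpleFunc.approxOn_mem measurable_id hy₀
  have hp : ∀ᵐ y ∂ν, y ∈ K ∧ Tendsto (fun n => p n y) atTop (𝓝 y) := hDν.mono fun y hy =>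
    ⟨hDK hy, SimpleFunc.tendsto_approxOn measurable_id hy₀ (subset_closure hy)⟩
  have hlim := tendsto_integral_smul_comp_simpleFunc hK hk hG (fun n y => hDK (hpD n y)) hp
  obtain ⟨ns, hns, hae⟩ := (tendstoInMeasure_of_tendsto_Lp hlim).exists_seq_tendsto_ae
  have hsum : ∀ᵐ x ∂μ, ∀ n, (∫ y, k y • G (p n y) ∂ν : Lp F q μ) x = ∫ y, k y • g (p n y) x ∂ν :=
    ae_all_iff.2 fun n => coeFn_integral_smul_comp_simpleFunc hk (p n) fun z hz => by
      obtain ⟨y, rfl⟩ := SimpleFunc.mem_range.1 hz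
      exact hGg _ (hpD n y)
  filter_upwards [hae, hsum, hg] with x hx hsumx ⟨h, hh, hgh⟩
  have hlimx := tendsto_integral_smul_comp_simpleFunc hK hk hh (fun n y => hDK (hpD n y)) hp
  have hkg : ∫ y, k y • g y x ∂ν = ∫ y, k y • h y ∂ν :=
    integral_congr_ae (hDν.mono fun y hy => congrArg (k y • ·) (hgh hy))
  rw [hkg]
  refine tendsto_nhds_unique hx ((hlimx.comp hns.tendsto_atTop).congr fun n => ?_)
  simp only [Function.comp_apply, hsumx, ← hgh (hpD _ _)]

end LpIntegral

section Energy

variable {M : Medium} {α T t : ℝ} {Ω : Set Plane} {E : ℝ → Plane → Plane} {H : ℝ → Plane → ℝ}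
  {P : ℝ → Plane → Plane}

lemma coeFn_toL2 {F : Type} [NormedAddCommGroup F] {f : Plane → F}
    (hf : MemLp f 2 (volume.restrict Ω)) : toL2 Ω f =ᵐ[volume.restrict Ω] f := by
  rw [toL2, dif_pos hf]
  exact hf.coeFn_toLp

lemma coeFn_fracIntegral {F : Type} [NormedAddCommGroup F] [NormedSpace ℝ F] [CompleteSpace F]
    (hα : 0 < α) (ht : 0 < t) {G : ℝ → L2 Ω F} (hG : ContinuousOn G (Icc 0 t))
    {g : ℝ → Plane → F} (hGg : ∀ s ∈ Ioo 0 t, G s =ᵐ[volume.restrict Ω] g s)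
    (hg : ∀ᵐ x ∂volume.restrict Ω,
      ∃ h : ℝ → F, ContinuousOn h (Icc 0 t) ∧ EqOn (fun s => g s x) h (Ioo 0 t)) :
    (fracIntegral α G t : L2 Ω F) =ᵐ[volume.restrict Ω]
      fun x => fracIntegral α (fun s => g s x) t := by
  have hmem : ∀ᵐ s ∂volume.restrict (Ioc 0 t), s ∈ Ioo 0 t := by
    rw [← restrict_Ioo_eq_restrict_Ioc]
    exact ae_restrict_mem measurableSet_Ioo
  have hk : Integrable (fun s => (t - s) ^ (α - 1)) (volume.restrict (Ioc 0 t)) :=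
    (intervalIntegrable_iff_integrableOn_Ioc_of_le ht.le).1 (intervalIntegrable_kernel hα t 0 t)
  simp only [fracIntegral, intervalIntegral.integral_of_le ht.le]
  filter_upwards [Lp.coeFn_smul (Real.Gamma α)⁻¹ (∫ s in Ioc 0 t, (t - s) ^ (α - 1) • G s),
    coeFn_integral_smul (nonempty_Ioo.2 ht) Ioo_subset_Icc_self isCompact_Icc hmem hk hG hGg hg]
    with x hsmul hx
  rw [hsmul, Pi.smul_apply, hx]

lemma fracIntegral_eq_toL2_sub (hα₀ : 0 < α) (hα₁ : α < 1)
    (hP : ∀ t ∈ Icc 0 T, MemLp (P t) 2 (volume.restrict Ω))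
    (hPt : ∀ᵐ x ∂volume.restrict Ω,
      HasL1Deriv T (fun t => P t x) ∧ HasContCaputo T α (fun t => P t x))
    {G : ℝ → L2 Ω Plane} (hG : ContinuousOn G (Icc 0 T))
    (hGP : ∀ t ∈ Ioo 0 T, G t =ᵐ[volume.restrict Ω] caputoField α P t) (ht : t ∈ Ioo 0 T) :
    fracIntegral α G t = toL2 Ω (P t) - toL2 Ω (P 0) := by
  have ht' : t ∈ Icc 0 T := Ioo_subset_Icc_self ht
  have hpointwise := coeFn_fracIntegral hα₀ ht.1 (hG.mono (Icc_subset_Icc_right ht.2.le))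
    (fun s hs => hGP s ⟨hs.1, hs.2.trans ht.2⟩) (hPt.mono fun x ⟨_, g, hg, hgeq⟩ =>
      ⟨g, hg.mono (Icc_subset_Icc_right ht.2.le), hgeq.mono (Ioo_subset_Ioo_right ht.2.le)⟩)
  apply Lp.ext
  filter_upwards [hpointwise, hPt, Lp.coeFn_sub (toL2 Ω (P t)) (toL2 Ω (P 0)),
    coeFn_toL2 (hP t ht'), coeFn_toL2 (hP 0 (left_mem_Icc.2 (ht'.1.trans ht'.2)))]
    with x hx hPx hsub hPtx hP0x
  rw [hx, hsub, Pi.sub_apply, hPtx, hP0x]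
  exact hPx.1.fracIntegral_caputo hα₀ hα₁ ht'

/-- The value `τ₀^(-α) (ε₀ (ε_s - ε_∞) E - P)` that the polarization law prescribes for the Caputo
derivative of `P`. Unlike `caputoField α P`, it is continuous up to the endpoints of `[0,T]`. -/
noncomputable def polarizationRate (M : Medium) (α : ℝ) (Ω : Set Plane)
    (E P : ℝ → Plane → Plane) (t : ℝ) : L2 Ω Plane :=
  (M.tau0 ^ α)⁻¹ • ((M.eps0 * (M.epsS - M.epsInf)) • toL2 Ω (E t) - toL2 Ω (P t))

lemma IsC1L2.contDiffAt {F : Type} [NormedAddCommGroup F] [NormedSpace ℝ F] {u : ℝ → Plane → F}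
    (h : IsC1L2 Ω T u) (ht : t ∈ Ioo 0 T) : ContDiffAt ℝ 1 (fun s => toL2 Ω (u s)) t :=
  h.contDiffOn.contDiffAt (Ioo_mem_nhds ht.1 ht.2)

lemma IsC1L2.hasDerivAt {F : Type} [NormedAddCommGroup F] [NormedSpace ℝ F] {u : ℝ → Plane → F}
    (h : IsC1L2 Ω T u) (ht : t ∈ Ioo 0 T) : HasDerivAt (fun s => toL2 Ω (u s)) (dt Ω u t) t :=
  ((h.contDiffAt ht).differentiableAt one_ne_zero).hasDerivAt

namespace IsWeakSolution

lemma toL2_caputoField (h : IsWeakSolution M α T Ω E H P) (ht : t ∈ Ioo 0 T) :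
    toL2 Ω (caputoField α P t) = polarizationRate M α Ω E P t := by
  rw [polarizationRate, eq_inv_smul_iff₀ (Real.rpow_pos_of_pos M.tau0_pos α).ne']
  refine ext_inner_right ℝ fun ψ => ?_
  rw [real_inner_smul_left, inner_sub_left, real_inner_smul_left]
  linarith [h.polarization t ht ψ]

lemma continuousOn_polarizationRate (h : IsWeakSolution M α T Ω E H P) :
    ContinuousOn (polarizationRate M α Ω E P) (Icc 0 T) :=
  ((h.regE.continuousOn.const_smul (M.eps0 * (M.epsS - M.epsInf))).sub
    h.regP.continuousOn).const_smul (M.tau0 ^ α)⁻¹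

lemma contDiffAt_polarizationRate (h : IsWeakSolution M α T Ω E H P) (ht : t ∈ Ioo 0 T) :
    ContDiffAt ℝ 1 (polarizationRate M α Ω E P) t :=
  (((h.regE.contDiffAt ht).const_smul _).sub (h.regP.contDiffAt ht)).const_smul _

lemma fracIntegral_norm_caputoField_sq (h : IsWeakSolution M α T Ω E H P) (ht : t ∈ Icc 0 T) :
    fracIntegral α (fun s => ‖toL2 Ω (caputoField α P s)‖ ^ 2) t
      = fracIntegral α (fun s => ‖polarizationRate M α Ω E P s‖ ^ 2) t :=
  fracIntegral_congr ht.1 fun s hs => by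
    simp only [h.toL2_caputoField ⟨hs.1, hs.2.trans_le ht.2⟩]

lemma hasDerivAt_fracIntegral (hα₀ : 0 < α) (hα₁ : α < 1) (h : IsWeakSolution M α T Ω E H P)
    (ht : t ∈ Ioo 0 T) :
    HasDerivAt (fracIntegral α (polarizationRate M α Ω E P)) (dt Ω P t) t := by
  refine ((h.regP.hasDerivAt ht).sub_const (toL2 Ω (P 0))).congr_of_eventuallyEq ?_
  filter_upwards [Ioo_mem_nhds ht.1 ht.2] with τ hτ
  exact fracIntegral_eq_toL2_sub hα₀ hα₁ h.regP.memLp h.regPt h.continuousOn_polarizationRate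
    (fun s hs => h.toL2_caputoField hs ▸ coeFn_toL2 (h.memCaputo s hs)) hτ

lemma hasDerivAt_energy (hα : 0 < α) (h : IsWeakSolution M α T Ω E H P) (ht : t ∈ Ioo 0 T) :
    HasDerivAt (energy M α Ω E H P)
      (M.tau0 ^ α * deriv (fracIntegral α fun s => ‖polarizationRate M α Ω E P s‖ ^ 2) t
        + 2 * inner ℝ (toL2 Ω (P t)) (dt Ω P t)
        + M.eps0 * (M.epsS - M.epsInf) *
          (M.eps0 * M.epsInf * (2 * inner ℝ (toL2 Ω (E t)) (dt Ω E t))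
            + M.mu0 * (2 * inner ℝ (toL2 Ω (H t)) (dt Ω H t)))) t := by
  have hfrac := (differentiableAt_fracIntegral hα (h.continuousOn_polarizationRate.norm.pow 2) ht
    ((h.contDiffAt_polarizationRate ht).norm_sq ℝ)).hasDerivAt
  have hfield := ((h.regE.hasDerivAt ht).norm_sq.const_mul (M.eps0 * M.epsInf)).add
    ((h.regH.hasDerivAt ht).norm_sq.const_mul M.mu0)
  refine (((hfrac.const_mul (M.tau0 ^ α)).add (h.regP.hasDerivAt ht).norm_sq).add
    (hfield.const_mul (M.eps0 * (M.epsS - M.epsInf)))).congr_of_eventuallyEq ?_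
  filter_upwards [Ioo_mem_nhds ht.1 ht.2] with τ hτ
  simp only [energy, h.fracIntegral_norm_caputoField_sq (Ioo_subset_Icc_self hτ)]
  rfl

lemma poynting_identity (h : IsWeakSolution M α T Ω E H P) (ht : t ∈ Ioo 0 T) :
    M.eps0 * M.epsInf * inner ℝ (toL2 Ω (E t)) (dt Ω E t)
      + M.mu0 * inner ℝ (toL2 Ω (H t)) (dt Ω H t) = -inner ℝ (toL2 Ω (E t)) (dt Ω P t) := by
  have hE := h.ampere t ht (E t) (h.memE t ht)
  have hH := h.faraday t ht (toL2 Ω (H t))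
  rw [real_inner_comm (toL2 Ω (E t)), real_inner_comm (toL2 Ω (E t))] at hE
  rw [real_inner_comm (toL2 Ω (H t)), real_inner_comm (toL2 Ω (H t))] at hH
  linarith

lemma deriv_energy_add_nonpos (hα₀ : 0 < α) (hα₁ : α < 1) (h : IsWeakSolution M α T Ω E H P)
    (ht : t ∈ Ioo 0 T) :
    deriv (energy M α Ω E H P) t
      + M.tau0 ^ α * eta α t * ‖toL2 Ω (caputoField α P t)‖ ^ 2 ≤ 0 := by
  have hchain := mul_le_mul_of_nonneg_left (deriv_fracIntegral_norm_sq_add_le hα₀ hα₁.le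
    h.continuousOn_polarizationRate ht (h.contDiffAt_polarizationRate ht)
    (h.hasDerivAt_fracIntegral hα₀ hα₁ ht)) (Real.rpow_nonneg M.tau0_pos.le α)
  have hpolarization := h.polarization t ht (dt Ω P t)
  have hpoynting := congrArg (M.eps0 * (M.epsS - M.epsInf) * ·) (h.poynting_identity ht)
  rw [h.toL2_caputoField ht] at hpolarization ⊢
  rw [(h.hasDerivAt_energy hα₀ ht).deriv]
  linarith

lemma continuousOn_energy (hα : 0 < α) (h : IsWeakSolution M α T Ω E H P) :
    ContinuousOn (energy M α Ω E H P) (Icc 0 T) := by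
  have hfrac : ContinuousOn (fracIntegral α fun s => ‖toL2 Ω (caputoField α P s)‖ ^ 2) (Icc 0 T) :=
    (continuousOn_fracIntegral hα (h.continuousOn_polarizationRate.norm.pow 2)).congr
      fun t ht => h.fracIntegral_norm_caputoField_sq ht
  have hE := h.regE.continuousOn
  have hH := h.regH.continuousOn
  have hP := h.regP.continuousOn
  unfold energy
  fun_prop

lemma antitoneOn_energy (hα₀ : 0 < α) (hα₁ : α < 1) (h : IsWeakSolution M α T Ω E H P) :
    AntitoneOn (energy M α Ω E H P) (Icc 0 T) := by
  refine antitoneOn_of_deriv_nonpos (convex_Icc 0 T) (h.continuousOn_energy hα₀) ?_ ?_ <;>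
    rw [interior_Icc]
  · exact fun t ht => (h.hasDerivAt_energy hα₀ ht).differentiableAt.differentiableWithinAt
  · intro t ht
    have hdamping : 0 ≤ M.tau0 ^ α * eta α t * ‖toL2 Ω (caputoField α P t)‖ ^ 2 :=
      mul_nonneg (mul_nonneg (Real.rpow_nonneg M.tau0_pos.le α) (eta_nonneg hα₀ ht.1.le))
        (sq_nonneg _)
    linarith [h.deriv_energy_add_nonpos hα₀ hα₁ ht]

end IsWeakSolution

end Energy

end ColeCole

theorem lemma2_general (M : ColeCole.Medium) (α : ℝ) (hα : α ∈ Set.Ioo (0 : ℝ) 1) (T : ℝ)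
    (Ω : Set ColeCole.Plane) (E : ℝ → ColeCole.Plane → ColeCole.Plane) (H : ℝ → ColeCole.Plane → ℝ)
    (P : ℝ → ColeCole.Plane → ColeCole.Plane) (hsol : ColeCole.IsWeakSolution M α T Ω E H P) :
    (∀ t ∈ Set.Ioo 0 T,
      DifferentiableAt ℝ (ColeCole.energy M α Ω E H P) t ∧
      deriv (ColeCole.energy M α Ω E H P) t
        + M.tau0 ^ α * ColeCole.eta α t *
          ‖ColeCole.toL2 Ω (ColeCole.caputoField α P t)‖ ^ 2 ≤ 0) ∧
    AntitoneOn (ColeCole.energy M α Ω E H P) (Set.Icc 0 T) :=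
  ⟨fun _ ht => ⟨(hsol.hasDerivAt_energy hα.1 ht).differentiableAt,
    hsol.deriv_energy_add_nonpos hα.1 hα.2 ht⟩, hsol.antitoneOn_energy hα.1 hα.2⟩

theorem lemma2 (M : ColeCole.Medium) (α : ℝ) (hα : α ∈ Set.Ioo (0 : ℝ) 1)
    (T : ℝ) (hT : 0 < T) (a b c d : ℝ) (hab : a < b) (hcd : c < d)
    (E : ℝ → ColeCole.Plane → ColeCole.Plane) (H : ℝ → ColeCole.Plane → ℝ)
    (P : ℝ → ColeCole.Plane → ColeCole.Plane)
    (hsol : ColeCole.IsWeakSolution M α T (ColeCole.rectangle a b c d) E H P) :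
    (∀ t ∈ Set.Ioo 0 T,
      DifferentiableAt ℝ (ColeCole.energy M α (ColeCole.rectangle a b c d) E H P) t ∧
      deriv (ColeCole.energy M α (ColeCole.rectangle a b c d) E H P) t
        + M.tau0 ^ α * ColeCole.eta α t *
          ‖ColeCole.toL2 (ColeCole.rectangle a b c d) (ColeCole.caputoField α P t)‖ ^ 2 ≤ 0) ∧
    AntitoneOn (ColeCole.energy M α (ColeCole.rectangle a b c d) E H P) (Set.Icc 0 T) :=
  lemma2_general M α hα T _ E H P hsol
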